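/- Let $\mathbb F$ be a field or skew field with an involution $a\mapsto\tilde a$ (so $\widetilde{a+b}=\tilde a+\tilde b$, $\widetilde{ab}=\tilde b\,\tilde a$, $\tilde{\tilde a}=a$). For a matrix $A=[a_{ij}]$ over $\mathbb F$ put $A^*=[\tilde a_{ji}]$; square matrices $A,B$ are *congruent if $S^*AS=B$ for some nonsingular $S$. Let $J_k$ be the $k\times k$ nilpotent Jordan block (ones on the first superdiagonal, zeros elsewhere), and let $A^{[k]}$ be the direct sum of $k$ copies of $A$. The $0\times 0$ matrix counts as nonsingular. Linear independence of rows is over $\mathbb F$ acting on the left. One stage of the regularization algorithm takes a singular square matrix $A$ to a smaller square matrix $A_{(1)}$ and integers $m_1,m_2$ as follows. Step 1: choose a nonsingular $S$ with $SA=\begin{bmatrix}A'\\0\end{bmatrix}$, where the rows of $A'$ are linearly independent and there are $m_1$ zero rows, and write $SAS^*=\begin{bmatrix}M&N\\0&0_{m_1}\end{bmatrix}$ with $M$ square. Step 2: choose a nonsingular $R$ with $RN=\begin{bmatrix}0\\E\end{bmatrix}$, where the rows of $E$ are linearly independent and $E$ has $m_2$ rows, and write $$(R\oplus I)\begin{bmatrix}M&N\\0&0\end{bmatrix}(R\oplus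 I)^*=\begin{bmatrix}A_{(1)}&B&0\\C&D&E\\0&0&0_{m_1}\end{bmatrix}$$ with $D$ of size $m_2\times m_2$. The algorithm starts with $A_{(0)}=A$; as long as $A_{(k-1)}$ is singular, it applies a stage to $A_{(k-1)}$ and obtains $m_{2k-1}$, $m_{2k}$ and $A_{(k)}$. It stops at the first $\tau$ for which $A_{(\tau)}$ is nonsingular. Theorem. Let $A$ be a singular $n\times n$ matrix over $\mathbb F$. The algorithm can be carried out on $A$: whatever choices have been made, a stage can be performed as long as the current matrix is singular, every stage strictly decreases the size, and the algorithm stops after at most $n$ stages. For every run of it on $A$, with result $\tau$, $m_1,\dots,m_{2\tau}$, $A_{(\tau)}$, we have $m_1\ge m_2\ge\cdots\ge m_{2\tau}\ge 0$, the matrix $A_{(\tau)}$ is nonsingular, and $A$ is *congruent to $$A_{(\tau)}\oplus J_1^{[m_1-m_2]}\oplus J_2^{[m_2-m_3]}\oplus\cdots\oplus J_{2\tau-1}^{[m_{2\tau-1}-m_{2\tau}]}\oplus J_{2\tau}^{[m_{2\tau}]}.$$ The number $\tau$, the integers $m_1,\dots,m_{2\tau}$ and the *congruence class of $A_{(\tau)}$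 are uniquely determined by the *congruence class of $A$: any runs of the algorithm on any two *congruent singular matrices yield the same $\tau$, the same integers $m_i$, and *congruent final matrices. -/

import Mathlib

open Matrix

namespace StarReg

/-- `A` and `B` are *congruent: `Sᴴ * A * S = B` for some nonsingular square `S`, where `Sᴴ` is the
transpose of the entrywise conjugate of `S`. The index types of `A` and `B` may differ (block
matrices are indexed by sums), so they are identified by a bijection; reordering the indices is
itself a *congruence. -/
def StarCongruent {F : Type*} [DivisionRing F] [StarRing F] {ι κ : Type*}
    [Fintype ι] [DecidableEq ι] (A : Matrix ι ι F) (B : Matrix κ κ F) : Prop :=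
  ∃ (e : ι ≃ κ) (S : Matrix ι ι F), IsUnit S ∧ Sᴴ * A * S = B.submatrix e e

/-- The direct sum of two square matrices. -/
def directSum {F : Type*} [DivisionRing F] {ι κ : Type*}
    (A : Matrix ι ι F) (B : Matrix κ κ F) : Matrix (ι ⊕ κ) (ι ⊕ κ) F :=
  fromBlocks A 0 0 B

/-- The `k`-by-`k` singular Jordan block `J_k`, with ones on the first superdiagonal. -/
def jordan (F : Type*) [DivisionRing F] (k : ℕ) : Matrix (Fin k) (Fin k) F :=
  Matrix.of fun i j => if (i : ℕ) + 1 = (j : ℕ) then 1 else 0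

/-- For a list `[m₁, …, m_L]` the matrix
`J₁^[m₁ - m₂] ⊕ J₂^[m₂ - m₃] ⊕ ⋯ ⊕ J_{L-1}^[m_{L-1} - m_L] ⊕ J_L^[m_L]`.
List positions start at `0`, so the entry at position `i` is `m_{i+1}`; past the end it is read
as `0`. -/
def singularPart (F : Type*) [DivisionRing F] (ms : List ℕ) :
    Matrix (Σ i : Fin ms.length, Fin ((i : ℕ) + 1) × Fin (ms.getD i 0 - ms.getD (i + 1) 0))
      (Σ i : Fin ms.length, Fin ((i : ℕ) + 1) × Fin (ms.getD i 0 - ms.getD (i + 1) 0)) F :=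
  blockDiagonal' fun i : Fin ms.length =>
    blockDiagonal fun _ : Fin (ms.getD i 0 - ms.getD (i + 1) 0) => jordan F ((i : ℕ) + 1)

/-- The partition of `n = p + q` indices into the first `p` and the last `q`. -/
def split {p q n : ℕ} (h : p + q = n) : Fin p ⊕ Fin q ≃ Fin n :=
  finSumFinEquiv.trans (finCongr h)

/-- One stage (Steps 1 and 2, with all choices made) of the regularization algorithm: it takes the
`n`-by-`n` matrix `A` to the `a`-by-`a` matrix `A₁` and produces the integers `m₁` and `m₂`. -/
structure StageData {F : Type*} [DivisionRing F] [StarRing F] {n : ℕ}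
    (A : Matrix (Fin n) (Fin n) F) (m₁ m₂ : ℕ) {a : ℕ} (A₁ : Matrix (Fin a) (Fin a) F) where
  /-- The number of nonzero rows left by Step 1. -/
  r : ℕ
  size₁ : r + m₁ = n
  S : Matrix (Fin n) (Fin n) F
  S_nonsingular : IsUnit S
  A' : Matrix (Fin r) (Fin n) F
  /-- The rows of `A'` are linearly independent (as left vectors). -/
  A'_rows : LinearIndependent F A'.row
  /-- `S A = [A'; 0]`, with `m₁` zero rows at the bottom. -/
  step₁_rows : (S * A).submatrix (split size₁) id = fromRows A' 0
  M : Matrix (Fin r) (Fin r) F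
  N : Matrix (Fin r) (Fin m₁) F
  /-- `S A S^* = [M N; 0 0]` with `M` square. -/
  step₁ : (S * A * Sᴴ).submatrix (split size₁) (split size₁) = fromBlocks M N 0 0
  size₂ : a + m₂ = r
  R : Matrix (Fin r) (Fin r) F
  R_nonsingular : IsUnit R
  E : Matrix (Fin m₂) (Fin m₁) F
  /-- The rows of `E` are linearly independent (as left vectors). -/
  E_rows : LinearIndependent F E.row
  /-- `R N = [0; E]`. -/
  step₂_rows : (R * N).submatrix (split size₂) id = fromRows 0 E
  B : Matrix (Fin a) (Fin m₂) F
  C : Matrix (Fin m₂) (Fin a) F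
  D : Matrix (Fin m₂) (Fin m₂) F
  /-- `(R ⊕ I) [M N; 0 0] (R ⊕ I)^* = [A₁ B 0; C D E; 0 0 0]`. -/
  step₂ :
    (directSum R (1 : Matrix (Fin m₁) (Fin m₁) F) * fromBlocks M N 0 0 *
        (directSum R (1 : Matrix (Fin m₁) (Fin m₁) F))ᴴ).submatrix
      (Sum.map (split size₂) id) (Sum.map (split size₂) id) =
    fromBlocks (fromBlocks A₁ B C D) (fromRows 0 E) 0 0

/-- `Stages A k ms B`: for some choices of the transformations, `k` stages of the regularization
algorithm, each applied to a singular matrix, take `A` to `B = A_(k)` and produce the integers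
`ms = [m₁, m₂, …, m_{2k}]`. -/
inductive Stages {F : Type*} [DivisionRing F] [StarRing F] :
    {n : ℕ} → Matrix (Fin n) (Fin n) F → ℕ → List ℕ → {a : ℕ} → Matrix (Fin a) (Fin a) F → Prop
  | nil {n : ℕ} (A : Matrix (Fin n) (Fin n) F) : Stages A 0 [] A
  | cons {n a b : ℕ} {A : Matrix (Fin n) (Fin n) F} {A₁ : Matrix (Fin a) (Fin a) F}
      {B : Matrix (Fin b) (Fin b) F} {m₁ m₂ k : ℕ} {ms : List ℕ}
      (singular : ¬ IsUnit A) (stage : StageData A m₁ m₂ A₁) (rest : Stages A₁ k ms B) :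
      Stages A (k + 1) (m₁ :: m₂ :: ms) B

/-- A terminated run of the algorithm on `A`: after `τ` stages the matrix `B = A_(τ)` is
nonsingular (and, by `Stages`, no earlier `A_(k)` is). -/
def Run {F : Type*} [DivisionRing F] [StarRing F] {n : ℕ} (A : Matrix (Fin n) (Fin n) F)
    (τ : ℕ) (ms : List ℕ) {a : ℕ} (B : Matrix (Fin a) (Fin a) F) : Prop :=
  Stages A τ ms B ∧ IsUnit B

end StarReg

/-! Over a division ring, linear independence of rows means existence of a right inverse, so the
whole argument is block multiplication.

Uniqueness. A stage replaces `A` by a *congruent matrix `[A₁ B 0; C D E; 0 0 0]` in which `E` and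
the two upper block rows together have independent rows. If `Z` carries one such matrix to another,
then the zero rows, which span the left kernel, must correspond. So `Z` and its inverse are block
upper triangular. Comparing the last block column, where only `E` is nonzero, then forces the block
of `Z` from the `B`-columns into the `A₁`-rows to vanish. The leading block of `Z` is therefore
invertible and carries `A₁` to `A₁'`, and the block sizes agree (`cong_of_cong_stageForm`).
Induction over stages does the rest, since nonsingularity is a *congruence invariant and two runs
stop together.

Decomposition. The singular part is treated as a partial shift on a diagram of positions `(l, x)`
with `x < m_{l+1}`: the row at `(l + 1, x)` is the unit row at `(l, x)`, and the rows at `(0, x)`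
are zero. Stages are undone from the last one back. If `A₁` is already `A_(τ)` plus a shift, then
`E` clears `C` and `D`, the columns of `A₁` clear most of `B`, and what remains of `B` and `E`
becomes unit rows (`stageForm_cong_ladder`). This prepends columns of heights `m₁` and `m₂` to the
diagram, and independence of rows gives `m₃ ≤ m₂ ≤ m₁`. Finally, each horizontal line of the diagram
is one Jordan block, and exactly `m_i - m_{i+1}` lines have length `i`. -/

namespace StarReg

set_option linter.unusedSectionVars false

/-! ### Independent rows, completion and row reduction over a division ring -/

section LinearAlgebra

variable {F : Type*} [DivisionRing F] {ι κ μ ν : Type*} [Fintype ι] [DecidableEq ι]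
  [Fintype κ] [DecidableEq κ] [Fintype μ] [DecidableEq μ] [Fintype ν] [DecidableEq ν]

/-- `K` has a right inverse; over a division ring this says that its rows are left linearly
independent. -/
def HasRightInv (K : Matrix ι κ F) : Prop := ∃ L : Matrix κ ι F, K * L = 1

theorem linearIndependent_row_iff_hasRightInv {K : Matrix ι κ F} :
    LinearIndependent F K.row ↔ HasRightInv K := by
  rw [← Matrix.vecMul_injective_iff]
  constructor
  · intro h
    obtain ⟨g, hg⟩ := LinearMap.exists_leftInverse_of_injective K.toLinearMapRight'
      (LinearMap.ker_eq_bot.2 h)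
    refine ⟨LinearMap.toMatrixRight' g, ?_⟩
    have := congrArg LinearMap.toMatrixRight' hg
    rw [LinearMap.toMatrixRight'_comp, LinearMap.toMatrixRight'_id] at this
    simpa using this
  · rintro ⟨L, hL⟩ u v huv
    have := congrArg (· ᵥ* L) huv
    simpa [Matrix.vecMul_vecMul, hL] using this

theorem HasRightInv.eq_zero_of_mul {K : Matrix ι κ F} (h : HasRightInv K) {α : Type*}
    {U : Matrix α ι F} (hU : U * K = 0) : U = 0 := by
  obtain ⟨L, hL⟩ := h
  rw [← Matrix.mul_one U, ← hL, ← Matrix.mul_assoc, hU, Matrix.zero_mul]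

theorem HasRightInv.isUnit {K : Matrix ι ι F} (h : HasRightInv K) : IsUnit K := by
  obtain ⟨L, hL⟩ := h
  exact ⟨⟨K, L, hL, mul_eq_one_comm.1 hL⟩, rfl⟩

theorem HasRightInv.card_le {K : Matrix ι κ F} (h : HasRightInv K) :
    Fintype.card ι ≤ Fintype.card κ :=
  _root_.card_le_of_injective F K.toLinearMapRight'
    (Matrix.vecMul_injective_iff.2 (linearIndependent_row_iff_hasRightInv.2 h))

theorem HasRightInv.mul {K : Matrix ι κ F} {V : Matrix κ μ F} (h : HasRightInv K)
    (hV : HasRightInv V) : HasRightInv (K * V) := by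
  obtain ⟨L, hL⟩ := h
  obtain ⟨W, hW⟩ := hV
  refine ⟨W * L, ?_⟩
  rw [Matrix.mul_assoc, ← Matrix.mul_assoc V, hW, Matrix.one_mul, hL]

theorem _root_.IsUnit.hasRightInv {K : Matrix ι ι F} (h : IsUnit K) : HasRightInv K := by
  obtain ⟨u, rfl⟩ := h
  exact ⟨_, u.mul_inv⟩

theorem HasRightInv.submatrix {K : Matrix ι κ F} (h : HasRightInv K) {f : μ → ι}
    (hf : Function.Injective f) (e : ν ≃ κ) : HasRightInv (K.submatrix f e) := by
  obtain ⟨L, hL⟩ := h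
  refine ⟨L.submatrix e f, ?_⟩
  rw [Matrix.submatrix_mul_equiv, hL, Matrix.submatrix_one _ hf]

theorem HasRightInv.of_fromCols_zero {K : Matrix ι κ F}
    (h : HasRightInv (fromCols K (0 : Matrix ι μ F))) : HasRightInv K := by
  obtain ⟨L, hL⟩ := h
  refine ⟨L.submatrix Sum.inl id, ?_⟩
  rw [← fromRows_toRows L, fromCols_mul_fromRows, Matrix.zero_mul, add_zero] at hL
  exact hL

/-- A family of independent rows can be completed to a nonsingular matrix, with the given rows in
prescribed places. -/
theorem HasRightInv.exists_isUnit_rows {K : Matrix κ ι F} (h : HasRightInv K) {f : κ → ι}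
    (hf : Function.Injective f) : ∃ V : Matrix ι ι F, IsUnit V ∧ V.submatrix f id = K := by
  have hli := linearIndependent_row_iff_hasRightInv.2 h
  let b := Module.Basis.sumExtend hli
  have hb : ∀ i, b (Sum.inl i) = K i := fun i => by
    simp only [b, Module.Basis.sumExtend, Module.Basis.reindex_apply]
    erw [Module.Basis.extend_apply_self]
    rfl
  have : Finite (κ ⊕ Module.Basis.sumExtendIndex hli) := Module.Finite.finite_basis b
  have : Finite (Module.Basis.sumExtendIndex hli) :=
    Finite.of_injective (Sum.inr : _ → κ ⊕ _) Sum.inr_injective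
  let _ := Fintype.ofFinite (Module.Basis.sumExtendIndex hli)
  have hc : Fintype.card (κ ⊕ Module.Basis.sumExtendIndex hli) = Fintype.card ι := by
    rw [← Module.finrank_eq_card_basis b, Module.finrank_fintype_fun_eq_card]
  -- The added basis vectors are as many as the places outside the range of `f`, so they can be put
  -- there.
  have hc' : Fintype.card (Module.Basis.sumExtendIndex hli) =
      Fintype.card {j // j ∉ Set.range f} := by
    have h1 : Fintype.card {j // j ∈ Set.range f} = Fintype.card κ :=
      (Fintype.card_congr (Equiv.ofInjective f hf)).symm
    have h2 := Fintype.card_subtype_compl (fun j => j ∈ Set.range f)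
    have h3 := Fintype.card_subtype_le (fun j => j ∈ Set.range f)
    rw [Fintype.card_sum] at hc
    omega
  let σ : κ ⊕ Module.Basis.sumExtendIndex hli ≃ ι :=
    (Equiv.sumCongr (Equiv.ofInjective f hf) (Fintype.equivOfCardEq hc')).trans
      (Equiv.sumCompl (· ∈ Set.range f))
  have hσ : ∀ i, σ (Sum.inl i) = f i := fun i => by simp [σ]
  refine ⟨Matrix.of (b.reindex σ), ?_, ?_⟩
  · exact (linearIndependent_row_iff_hasRightInv.1 (b.reindex σ).linearIndependent).isUnit
  · ext i j
    rw [Matrix.submatrix_apply, Matrix.of_apply, Module.Basis.reindex_apply, ← hσ,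
      Equiv.symm_apply_apply, hb, id]

/-- The matrix with the unit row `e_{f i}` in position `i`. -/
def unitRows (F : Type*) [DivisionRing F] {κ ι : Type*} [DecidableEq ι] (f : κ → ι) :
    Matrix κ ι F :=
  Matrix.of fun i j => if f i = j then 1 else 0

theorem unitRows_mul {α : Type*} (f : κ → ι) (V : Matrix ι α F) :
    unitRows F f * V = V.submatrix f id := by
  ext i j
  simp [unitRows, Matrix.mul_apply]

/-- Complete `K` to a nonsingular `V`; then `K` is the selection of rows `f` from `V`, and `V⁻¹`
turns it into unit rows. -/
theorem HasRightInv.exists_mul_eq_unitRows {K : Matrix κ ι F} (h : HasRightInv K) {f : κ → ι}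
    (hf : Function.Injective f) : ∃ Y : Matrix ι ι F, IsUnit Y ∧ K * Y = unitRows F f := by
  obtain ⟨V, ⟨u, rfl⟩, rfl⟩ := h.exists_isUnit_rows hf
  refine ⟨_, (u⁻¹).isUnit, ?_⟩
  rw [← unitRows_mul, Matrix.mul_assoc, Units.mul_inv, Matrix.mul_one]

/-- Row reduction: left multiplication by a nonsingular matrix makes some rows zero and the others
independent. -/
theorem exists_row_reduction {n : ℕ} (A : Matrix (Fin n) κ F) :
    ∃ q r : ℕ, q + r = n ∧ ∀ σ : Fin q ⊕ Fin r ≃ Fin n, ∃ (S : Matrix (Fin n) (Fin n) F)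
      (A' : Matrix (Fin r) κ F), IsUnit S ∧ HasRightInv A' ∧
        (S * A).submatrix σ id = fromRows 0 A' := by
  -- The zero rows come from a basis of the left kernel of `A`, completed to a nonsingular `S`.
  let k := LinearMap.ker A.toLinearMapRight'
  have hq : Module.finrank F k ≤ n := by
    simpa using Submodule.finrank_le k
  refine ⟨Module.finrank F k, n - Module.finrank F k, by omega, fun σ => ?_⟩
  let b := Module.finBasis F k
  let K : Matrix (Fin (Module.finrank F k)) (Fin n) F := Matrix.of fun i => (b i : Fin n → F)
  have hK : HasRightInv K := linearIndependent_row_iff_hasRightInv.1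
    (b.linearIndependent.map' k.subtype (Submodule.ker_subtype k))
  obtain ⟨S, hS, hSK⟩ := hK.exists_isUnit_rows (σ.injective.comp Sum.inl_injective)
  refine ⟨S, (S * A).submatrix (σ ∘ Sum.inr) id, hS, ?_, ?_⟩
  · rw [← linearIndependent_row_iff_hasRightInv, ← Matrix.vecMul_injective_iff,
      ← Matrix.coe_vecMulLinear, ← LinearMap.ker_eq_bot, LinearMap.ker_eq_bot']
    intro u hu
    -- A relation `u` among the remaining rows, padded by zeros to `w`, puts `w ᵥ* S` in the left
    -- kernel, hence in the span of the kernel rows of `S`. Coordinates with respect to the rows of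
    -- `S` are unique, so `u = 0`.
    let w : Fin n → F := Sum.elim 0 u ∘ σ.symm
    have hw : ∀ {α : Type _} (T : Matrix (Fin n) α F),
        w ᵥ* T = u ᵥ* T.submatrix (σ ∘ Sum.inr) id := fun T => by
      ext j
      simp only [Matrix.vecMul, dotProduct]
      rw [← σ.sum_comp]
      simp [w]
    have hwk : w ᵥ* S ∈ k := by
      change (w ᵥ* S) ᵥ* A = 0
      rw [Matrix.vecMul_vecMul, hw]
      exact hu
    let c := b.repr ⟨_, hwk⟩
    have hc : ∑ i, c i • K i = w ᵥ* S := by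
      have := congrArg k.subtype (b.sum_repr ⟨_, hwk⟩)
      rw [map_sum] at this
      exact this
    let w' : Fin n → F := Sum.elim c 0 ∘ σ.symm
    have hw' : w' ᵥ* S = w ᵥ* S := by
      rw [← hc, ← hSK]
      ext j
      simp only [Matrix.vecMul, dotProduct]
      rw [← σ.sum_comp]
      simp [w']
    have hww := Matrix.vecMul_injective_of_isUnit hS hw'
    ext j
    have := congrFun hww (σ (Sum.inr j))
    simpa [w, w'] using this.symm
  · ext (i | i) j
    · have h1 : (S * A) (σ (Sum.inl i)) j = (K i ᵥ* A) j := by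
        rw [← hSK]; rfl
      have h2 : K i ᵥ* A = 0 := (b i).2
      simp [h1, h2]
    · rfl

end LinearAlgebra

/-! ### *Congruence across index types -/

section Congruence

variable {F : Type*} [DivisionRing F] [StarRing F] {ι κ μ ν : Type*} [Fintype ι] [DecidableEq ι]
  [Fintype κ] [DecidableEq κ] [Fintype μ] [DecidableEq μ] [Fintype ν] [DecidableEq ν]

/-- *Congruence of matrices over different index types, by means of a rectangular matrix with a
two-sided inverse. -/
def Cong (A : Matrix ι ι F) (B : Matrix κ κ F) : Prop :=
  ∃ (Z : Matrix κ ι F) (W : Matrix ι κ F), Z * W = 1 ∧ W * Z = 1 ∧ Z * A * Zᴴ = B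

theorem Cong.symm {A : Matrix ι ι F} {B : Matrix κ κ F} (h : Cong A B) : Cong B A := by
  obtain ⟨Z, W, h1, h2, rfl⟩ := h
  refine ⟨W, Z, h2, h1, ?_⟩
  have h3 : Zᴴ * Wᴴ = 1 := by rw [← conjTranspose_mul, h2, conjTranspose_one]
  simp only [← Matrix.mul_assoc, h2, Matrix.one_mul]
  rw [Matrix.mul_assoc, h3, Matrix.mul_one]

theorem Cong.trans {A : Matrix ι ι F} {B : Matrix κ κ F} {C : Matrix μ μ F} (h : Cong A B)
    (h' : Cong B C) : Cong A C := by
  obtain ⟨Z, W, h1, h2, rfl⟩ := h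
  obtain ⟨Z', W', h1', h2', rfl⟩ := h'
  refine ⟨Z' * Z, W * W', ?_, ?_, ?_⟩
  · rw [Matrix.mul_assoc, ← Matrix.mul_assoc Z, h1, Matrix.one_mul, h1']
  · rw [Matrix.mul_assoc, ← Matrix.mul_assoc W', h2', Matrix.one_mul, h2]
  · simp only [conjTranspose_mul, Matrix.mul_assoc]

theorem Cong.submatrix (A : Matrix ι ι F) (e : κ ≃ ι) : Cong A (A.submatrix e e) := by
  refine ⟨(1 : Matrix ι ι F).submatrix e id, (1 : Matrix ι ι F).submatrix id e, ?_, ?_, ?_⟩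
  · rw [← Matrix.submatrix_mul _ _ _ _ _ Function.bijective_id, Matrix.mul_one,
      Matrix.submatrix_one_equiv]
  · rw [Matrix.submatrix_mul_equiv, Matrix.mul_one, Matrix.submatrix_id_id]
  · rw [conjTranspose_submatrix, conjTranspose_one]
    ext i j
    simp [Matrix.mul_apply, Matrix.one_apply]

theorem cong_mul (A : Matrix ι ι F) {Z : Matrix ι ι F} (hZ : IsUnit Z) : Cong A (Z * A * Zᴴ) := by
  obtain ⟨u, rfl⟩ := hZ
  exact ⟨_, _, u.mul_inv, u.inv_mul, rfl⟩

theorem card_eq_of_mul_eq_one {Z : Matrix κ ι F} {W : Matrix ι κ F} (h1 : Z * W = 1)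
    (h2 : W * Z = 1) : Fintype.card ι = Fintype.card κ :=
  card_eq_of_linearEquiv F (Matrix.toLinearEquivRight'OfInv h1 h2)

/-- An invertible rectangular matrix forces equally many indices on both sides, so some bijection
exists; any one will do, as `S` absorbs the reordering. -/
theorem cong_iff_starCongruent {A : Matrix ι ι F} {B : Matrix κ κ F} :
    Cong A B ↔ StarCongruent A B := by
  constructor
  · rintro ⟨Z, W, h1, h2, rfl⟩
    let e := Fintype.equivOfCardEq (card_eq_of_mul_eq_one h1 h2)
    refine ⟨e, (Z.submatrix e id)ᴴ, ?_, ?_⟩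
    · rw [← star_eq_conjTranspose, isUnit_star]
      refine HasRightInv.isUnit ⟨W.submatrix id e, ?_⟩
      rw [← Matrix.submatrix_mul _ _ _ _ _ Function.bijective_id, h1, Matrix.submatrix_one_equiv]
    · rw [conjTranspose_conjTranspose, conjTranspose_submatrix,
        Matrix.submatrix_mul _ _ _ _ _ Function.bijective_id,
        Matrix.submatrix_mul _ _ _ _ _ Function.bijective_id, Matrix.submatrix_id_id]
  · rintro ⟨e, S, hS, h⟩
    have hS' : IsUnit Sᴴ := isUnit_star.2 hS
    have h1 := cong_mul A hS'
    rw [conjTranspose_conjTranspose, h] at h1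
    exact h1.trans (Cong.submatrix B e).symm

theorem Cong.isUnit {A : Matrix ι ι F} {B : Matrix κ κ F} (h : Cong A B) (hA : IsUnit A) :
    IsUnit B := by
  obtain ⟨Z, W, h1, h2, rfl⟩ := h
  have h3 : Zᴴ * Wᴴ = 1 := by rw [← conjTranspose_mul, h2, conjTranspose_one]
  exact (((show HasRightInv Z from ⟨W, h1⟩).mul hA.hasRightInv).mul ⟨_, h3⟩).isUnit

end Congruence

/-! ### The block form after a stage, and its uniqueness -/

section BlockForm

variable {F : Type*} [DivisionRing F] [StarRing F] {ι κ μ ι' κ' μ' : Type*}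
  [Fintype ι] [DecidableEq ι] [Fintype κ] [DecidableEq κ] [Fintype μ] [DecidableEq μ]
  [Fintype ι'] [DecidableEq ι'] [Fintype κ'] [DecidableEq κ'] [Fintype μ'] [DecidableEq μ']

/-- The result `[A B 0; C D E; 0 0 0]` of a stage. -/
abbrev stageForm (A : Matrix ι ι F) (B : Matrix ι κ F) (C : Matrix κ ι F) (D : Matrix κ κ F)
    (E : Matrix κ μ F) : Matrix ((ι ⊕ κ) ⊕ μ) ((ι ⊕ κ) ⊕ μ) F :=
  fromBlocks (fromBlocks A B C D) (fromRows 0 E) 0 0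

theorem StageData.cong_stageForm {n a m₁ m₂ : ℕ} {A : Matrix (Fin n) (Fin n) F}
    {A₁ : Matrix (Fin a) (Fin a) F} (h : StageData A m₁ m₂ A₁) :
    Cong A (stageForm A₁ h.B h.C h.D h.E) := by
  have hR : IsUnit (directSum h.R (1 : Matrix (Fin m₁) (Fin m₁) F)) := by
    obtain ⟨L, hL⟩ := h.R_nonsingular.hasRightInv
    refine HasRightInv.isUnit ⟨directSum L 1, ?_⟩
    simp [directSum, fromBlocks_multiply, hL]
  have h1 := (cong_mul A h.S_nonsingular).trans (Cong.submatrix _ (split h.size₁))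
  rw [h.step₁] at h1
  have h2 := (h1.trans (cong_mul _ hR)).trans
    (Cong.submatrix _ (Equiv.sumCongr (split h.size₂) (Equiv.refl (Fin m₁))))
  rw [stageForm, ← h.step₂]
  exact h2

theorem StageData.hasRightInv_E {n a m₁ m₂ : ℕ} {A : Matrix (Fin n) (Fin n) F}
    {A₁ : Matrix (Fin a) (Fin a) F} (h : StageData A m₁ m₂ A₁) : HasRightInv h.E :=
  linearIndependent_row_iff_hasRightInv.1 h.E_rows

/-- The independence obtained in Step 1 survives: `[M N]` is `A'` times the nonsingular `Sᴴ`, and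
Step 2 multiplies it by nonsingular matrices on both sides. -/
theorem StageData.hasRightInv_top {n a m₁ m₂ : ℕ} {A : Matrix (Fin n) (Fin n) F}
    {A₁ : Matrix (Fin a) (Fin a) F} (h : StageData A m₁ m₂ A₁) :
    HasRightInv (fromCols (fromBlocks A₁ h.B h.C h.D) (fromRows 0 h.E)) := by
  have hMN : HasRightInv (fromCols h.M h.N) := by
    have h1 : fromCols h.M h.N = h.A' * (h.Sᴴ.submatrix id (split h.size₁)) := by
      have h2 := h.step₁
      rw [Matrix.submatrix_mul _ _ _ _ _ Function.bijective_id, h.step₁_rows,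
        fromRows_mul] at h2
      have h3 := congrArg (fun X => X.submatrix Sum.inl id) h2
      ext i (j | j)
      · exact (congrFun (congrFun h3 i) (Sum.inl j)).symm
      · exact (congrFun (congrFun h3 i) (Sum.inr j)).symm
    rw [h1]
    refine (linearIndependent_row_iff_hasRightInv.1 h.A'_rows).mul ?_
    have hS : IsUnit h.Sᴴ := isUnit_star.2 h.S_nonsingular
    exact hS.hasRightInv.submatrix Function.injective_id _
  have hR : IsUnit (directSum h.R (1 : Matrix (Fin m₁) (Fin m₁) F))ᴴ := by
    refine isUnit_star.2 ?_
    obtain ⟨L, hL⟩ := h.R_nonsingular.hasRightInv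
    refine HasRightInv.isUnit ⟨directSum L 1, ?_⟩
    simp [directSum, fromBlocks_multiply, hL]
  have h1 := ((h.R_nonsingular.hasRightInv.mul hMN).mul hR.hasRightInv).submatrix
    (split h.size₂).injective (Equiv.sumCongr (split h.size₂) (Equiv.refl (Fin m₁)))
  convert h1 using 1
  have h2 := congrArg (fun X => X.submatrix Sum.inl id) h.step₂
  have h3 : fromCols (fromBlocks A₁ h.B h.C h.D) (fromRows 0 h.E) =
      (fromBlocks (fromBlocks A₁ h.B h.C h.D) (fromRows 0 h.E) 0
        (0 : Matrix (Fin m₁) (Fin m₁) F)).submatrix Sum.inl id := by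
    ext i (j | j) <;> rfl
  have h4 : fromBlocks h.M h.N 0 (0 : Matrix (Fin m₁) (Fin m₁) F) =
      fromRows (fromCols h.M h.N) 0 := by
    ext (i | i) (j | j) <;> rfl
  have h5 : directSum h.R (1 : Matrix (Fin m₁) (Fin m₁) F) * fromRows (fromCols h.M h.N) 0 =
      fromRows (h.R * fromCols h.M h.N) 0 := by
    rw [directSum, fromBlocks_mul_fromRows]
    simp
  rw [h3, ← h.step₂, h4, h5, fromRows_mul]
  rfl

theorem HasRightInv.of_top {A : Matrix ι ι F} {B : Matrix ι κ F} {C : Matrix κ ι F}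
    {D : Matrix κ κ F} {E : Matrix κ μ F}
    (h : HasRightInv (fromCols (fromBlocks A B C D) (fromRows 0 E))) :
    HasRightInv (fromCols A B) := by
  refine HasRightInv.of_fromCols_zero (μ := μ) ?_
  convert h.submatrix Sum.inl_injective (Equiv.refl _) using 1
  ext i ((j | j) | j) <;> rfl

/-- Moving the right factor to the other side shows that `[Y V]` times the source form is zero. Only
`Y` meets its nonzero rows, and these are independent. -/
theorem toBlocks₂₁_eq_zero_of_stageForm {A : Matrix ι ι F} {B : Matrix ι κ F} {C : Matrix κ ι F}
    {D : Matrix κ κ F} {E : Matrix κ μ F} {A' : Matrix ι' ι' F} {B' : Matrix ι' κ' F}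
    {C' : Matrix κ' ι' F} {D' : Matrix κ' κ' F} {E' : Matrix κ' μ' F}
    (ht : HasRightInv (fromCols (fromBlocks A B C D) (fromRows 0 E)))
    {T : Matrix (ι' ⊕ κ') (ι ⊕ κ) F} {X : Matrix (ι' ⊕ κ') μ F} {Y : Matrix μ' (ι ⊕ κ) F}
    {V : Matrix μ' μ F} {W : Matrix ((ι ⊕ κ) ⊕ μ) ((ι' ⊕ κ') ⊕ μ') F}
    (hW : W * fromBlocks T X Y V = 1)
    (h : fromBlocks T X Y V * stageForm A B C D E * (fromBlocks T X Y V)ᴴ =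
      stageForm A' B' C' D' E') : Y = 0 := by
  have hZW : (fromBlocks T X Y V)ᴴ * Wᴴ = 1 := by
    rw [← conjTranspose_mul, hW, conjTranspose_one]
  have hX : fromBlocks T X Y V * stageForm A B C D E = stageForm A' B' C' D' E' * Wᴴ := by
    rw [← h, Matrix.mul_assoc _ _ Wᴴ, hZW, Matrix.mul_one]
  refine ht.eq_zero_of_mul ?_
  have h3 : (stageForm A' B' C' D' E' * Wᴴ).submatrix Sum.inr id = 0 := by
    ext i j
    simp [Matrix.mul_apply]
  rw [← hX, stageForm, fromBlocks_multiply] at h3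
  ext i (j | j)
  · simpa [mul_fromCols] using congrFun (congrFun h3 i) (Sum.inl j)
  · simpa [mul_fromCols] using congrFun (congrFun h3 i) (Sum.inr j)

/-- For triangular transformations the upper right block reads `Q * E * Vᴴ = 0`; cancelling `Vᴴ` and
`E` gives `Q = 0`, after which the leading block sees only `A`. -/
theorem toBlocks₁₁_of_stageForm {A : Matrix ι ι F} {B : Matrix ι κ F} {C : Matrix κ ι F}
    {D : Matrix κ κ F} {E : Matrix κ μ F} {A' : Matrix ι' ι' F} {B' : Matrix ι' κ' F}
    {C' : Matrix κ' ι' F} {D' : Matrix κ' κ' F} {E' : Matrix κ' μ' F} (hE : HasRightInv E)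
    {P : Matrix ι' ι F} {Q : Matrix ι' κ F} {R : Matrix κ' ι F} {U : Matrix κ' κ F}
    {X : Matrix (ι' ⊕ κ') μ F} {V : Matrix μ' μ F} {V' : Matrix μ μ' F} (hV : V' * V = 1)
    (h : fromBlocks (fromBlocks P Q R U) X 0 V * stageForm A B C D E *
      (fromBlocks (fromBlocks P Q R U) X 0 V)ᴴ = stageForm A' B' C' D' E') :
    Q = 0 ∧ P * A * Pᴴ = A' := by
  have hVV : Vᴴ * V'ᴴ = 1 := by rw [← conjTranspose_mul, hV, conjTranspose_one]
  rw [stageForm, stageForm, fromBlocks_conjTranspose, fromBlocks_multiply, fromBlocks_multiply,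
    fromBlocks_inj] at h
  simp only [fromBlocks_mul_fromRows, Matrix.mul_zero, add_zero, zero_add,
    conjTranspose_zero, fromRows_mul] at h
  obtain ⟨h11, h12, -, -⟩ := h
  have hQ : Q = 0 := by
    refine hE.eq_zero_of_mul ?_
    have h3 : Q * E * Vᴴ = 0 := (fromRows_inj h12).1
    rw [← Matrix.mul_one (Q * E), ← hVV, ← Matrix.mul_assoc, h3, Matrix.zero_mul]
  subst hQ
  refine ⟨rfl, ?_⟩
  rw [fromBlocks_conjTranspose, fromBlocks_multiply, fromBlocks_multiply] at h11
  ext i j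
  have := congrFun (congrFun h11 (Sum.inl i)) (Sum.inl j)
  simpa using this

/-- The outcome of a stage is determined up to *congruence. -/
theorem cong_of_cong_stageForm {A : Matrix ι ι F} {B : Matrix ι κ F} {C : Matrix κ ι F}
    {D : Matrix κ κ F} {E : Matrix κ μ F} {A' : Matrix ι' ι' F} {B' : Matrix ι' κ' F}
    {C' : Matrix κ' ι' F} {D' : Matrix κ' κ' F} {E' : Matrix κ' μ' F}
    (hE : HasRightInv E) (ht : HasRightInv (fromCols (fromBlocks A B C D) (fromRows 0 E)))
    (hE' : HasRightInv E') (ht' : HasRightInv (fromCols (fromBlocks A' B' C' D') (fromRows 0 E')))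
    (h : Cong (stageForm A B C D E) (stageForm A' B' C' D' E')) :
    Fintype.card μ = Fintype.card μ' ∧ Fintype.card κ = Fintype.card κ' ∧ Cong A A' := by
  obtain ⟨Z, W, h1, h2, h3⟩ := h
  have hc := card_eq_of_mul_eq_one h1 h2
  have h4 : W * stageForm A' B' C' D' E' * Wᴴ = stageForm A B C D E := by
    have h5 : Zᴴ * Wᴴ = 1 := by rw [← conjTranspose_mul, h2, conjTranspose_one]
    rw [← h3, ← Matrix.mul_assoc, ← Matrix.mul_assoc, h2, Matrix.one_mul, Matrix.mul_assoc, h5,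
      Matrix.mul_one]
  obtain ⟨T, X, Y, V, rfl⟩ : ∃ T X Y V, Z = fromBlocks T X Y V :=
    ⟨_, _, _, _, (fromBlocks_toBlocks Z).symm⟩
  obtain ⟨T', X', Y', V', rfl⟩ : ∃ T X Y V, W = fromBlocks T X Y V :=
    ⟨_, _, _, _, (fromBlocks_toBlocks W).symm⟩
  obtain rfl := toBlocks₂₁_eq_zero_of_stageForm ht h2 h3
  obtain rfl := toBlocks₂₁_eq_zero_of_stageForm ht' h1 h4
  obtain ⟨P, Q, R, U, rfl⟩ : ∃ P Q R U, T = fromBlocks P Q R U :=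
    ⟨_, _, _, _, (fromBlocks_toBlocks T).symm⟩
  obtain ⟨P', Q', R', U', rfl⟩ : ∃ P Q R U, T' = fromBlocks P Q R U :=
    ⟨_, _, _, _, (fromBlocks_toBlocks T').symm⟩
  rw [fromBlocks_multiply, ← fromBlocks_one, fromBlocks_inj] at h1 h2
  obtain ⟨hT1, -, -, hV1⟩ := h1
  obtain ⟨hT2, -, -, hV2⟩ := h2
  rw [Matrix.zero_mul, zero_add] at hV1 hV2
  rw [Matrix.mul_zero, add_zero, fromBlocks_multiply, ← fromBlocks_one, fromBlocks_inj] at hT1 hT2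
  obtain ⟨rfl, hA⟩ := toBlocks₁₁_of_stageForm hE hV2 h3
  -- With the corresponding block of the inverse also zero, `P` and `P'` are inverse to each other.
  obtain ⟨rfl, -⟩ := toBlocks₁₁_of_stageForm hE' hV1 h4
  have hP1 := hT1.1
  have hP2 := hT2.1
  rw [Matrix.zero_mul, add_zero] at hP1 hP2
  have hc1 := card_eq_of_mul_eq_one hV1 hV2
  have hc2 := card_eq_of_mul_eq_one hP1 hP2
  simp only [Fintype.card_sum] at hc
  exact ⟨hc1, by omega, P, P', hP1, hP2, hA⟩

theorem StageData.unique {n n' a a' m₁ m₂ m₁' m₂' : ℕ} {A : Matrix (Fin n) (Fin n) F}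
    {A' : Matrix (Fin n') (Fin n') F} {A₁ : Matrix (Fin a) (Fin a) F}
    {A₁' : Matrix (Fin a') (Fin a') F} (s : StageData A m₁ m₂ A₁) (s' : StageData A' m₁' m₂' A₁')
    (h : Cong A A') : m₁ = m₁' ∧ m₂ = m₂' ∧ Cong A₁ A₁' := by
  simpa using cong_of_cong_stageForm s.hasRightInv_E s.hasRightInv_top s'.hasRightInv_E
    s'.hasRightInv_top ((s.cong_stageForm.symm.trans h).trans s'.cong_stageForm)

end BlockForm

/-! ### Existence, termination and uniqueness of runs -/

section Runs

variable {F : Type*} [DivisionRing F] [StarRing F]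

theorem Stages.unique {n a k : ℕ} {A : Matrix (Fin n) (Fin n) F} {ms : List ℕ}
    {B : Matrix (Fin a) (Fin a) F} (s : Stages A k ms B) :
    ∀ {n' a' k' : ℕ} {A' : Matrix (Fin n') (Fin n') F} {ms' : List ℕ}
      {B' : Matrix (Fin a') (Fin a') F}, Stages A' k' ms' B' → IsUnit B → IsUnit B' →
      Cong A A' → k = k' ∧ ms = ms' ∧ Cong B B' := by
  induction s with
  | nil A =>
    intro n' a' k' A' ms' B' s' hB hB' h
    cases s' with
    | nil => exact ⟨rfl, rfl, h⟩
    | cons hs _ _ => exact absurd (h.isUnit hB) hs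
  | cons hs st _ ih =>
    intro n' a' k' A' ms' B' s' hB hB' h
    cases s' with
    | nil => exact absurd (h.symm.isUnit hB') hs
    | cons _ st' s' =>
      obtain ⟨rfl, rfl, h1⟩ := st.unique st' h
      obtain ⟨rfl, rfl, h2⟩ := ih s' hB hB' h1
      exact ⟨rfl, rfl, h2⟩

theorem exists_stageData {n : ℕ} (A : Matrix (Fin n) (Fin n) F) :
    ∃ (m₁ m₂ a : ℕ) (A₁ : Matrix (Fin a) (Fin a) F), Nonempty (StageData A m₁ m₂ A₁) := by
  obtain ⟨m₁, r, hr, H⟩ := exists_row_reduction A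
  have size₁ : r + m₁ = n := by omega
  -- Row reduction lists the zero rows first; swapping the summands puts them last, as Step 1
  -- requires. Step 2 needs no swap.
  obtain ⟨S, A', hS, hA', hSA⟩ := H ((Equiv.sumComm _ _).trans (split size₁))
  have hSA' : (S * A).submatrix (split size₁) id = fromRows A' 0 := by
    ext (i | i) j
    · exact congrFun (congrFun hSA (Sum.inr i)) j
    · exact congrFun (congrFun hSA (Sum.inl i)) j
  let X := A' * (Sᴴ.submatrix id (split size₁))
  have hX : (S * A * Sᴴ).submatrix (split size₁) (split size₁) =
      fromBlocks X.toCols₁ X.toCols₂ 0 0 := by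
    rw [Matrix.submatrix_mul _ _ _ _ _ Function.bijective_id, hSA', fromRows_mul,
      Matrix.zero_mul]
    ext (i | i) (j | j) <;> rfl
  obtain ⟨a, m₂, size₂, H⟩ := exists_row_reduction X.toCols₂
  obtain ⟨R, E, hR, hE, hRE⟩ := H (split size₂)
  let Y := (R * X.toCols₁ * Rᴴ).submatrix (split size₂) (split size₂)
  refine ⟨m₁, m₂, a, Y.toBlocks₁₁, ⟨⟨r, size₁, S, hS, A', ?_, hSA', _, _, hX, size₂, R, hR, E, ?_,
    hRE, Y.toBlocks₁₂, Y.toBlocks₂₁, Y.toBlocks₂₂, ?_⟩⟩⟩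
  · exact linearIndependent_row_iff_hasRightInv.2 hA'
  · exact linearIndependent_row_iff_hasRightInv.2 hE
  · rw [directSum, fromBlocks_conjTranspose, fromBlocks_multiply, fromBlocks_multiply, ← hRE,
      fromBlocks_toBlocks]
    ext (i | i) (j | j) <;> simp [Y]

/-- If `m₁ = 0`, Step 1 leaves no zero row, so `S * A` and hence `A` would be nonsingular. -/
theorem StageData.lt {n a m₁ m₂ : ℕ} {A : Matrix (Fin n) (Fin n) F}
    {A₁ : Matrix (Fin a) (Fin a) F} (s : StageData A m₁ m₂ A₁) (hA : ¬ IsUnit A) : a < n := by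
  have h1 := s.size₁
  have h2 := s.size₂
  rcases Nat.eq_zero_or_pos m₁ with h0 | h0
  · refine absurd ?_ hA
    subst h0
    have h3 : HasRightInv ((s.S * A).submatrix (split s.size₁) id) := by
      rw [s.step₁_rows]
      have h4 := (linearIndependent_row_iff_hasRightInv.1 s.A'_rows).submatrix
        (Equiv.sumEmpty _ (Fin 0)).injective (Equiv.refl (Fin n))
      convert h4 using 1
      ext (i | i) j
      · rfl
      · exact i.elim0
    have h5 := (h3.submatrix (split s.size₁).symm.injective (Equiv.refl _)).isUnit
    have h6 : ((s.S * A).submatrix (split s.size₁) id).submatrix (split s.size₁).symm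
        (Equiv.refl _) = s.S * A := by
      ext i j; simp
    rw [h6] at h5
    obtain ⟨u, hu⟩ := s.S_nonsingular
    rw [← hu] at h5
    exact (Units.isUnit_units_mul u A).1 h5
  · omega

theorem Stages.add_le {n a k : ℕ} {A : Matrix (Fin n) (Fin n) F} {ms : List ℕ}
    {B : Matrix (Fin a) (Fin a) F} (s : Stages A k ms B) : a + k ≤ n := by
  induction s with
  | nil A => simp
  | cons hs st _ ih =>
    have := st.lt hs
    omega

theorem exists_run {n : ℕ} (A : Matrix (Fin n) (Fin n) F) :
    ∃ (τ : ℕ) (ms : List ℕ) (a : ℕ) (B : Matrix (Fin a) (Fin a) F), Run A τ ms B := by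
  induction n using Nat.strong_induction_on with
  | _ n ih =>
    by_cases hA : IsUnit A
    · exact ⟨0, [], n, A, .nil A, hA⟩
    · obtain ⟨m₁, m₂, a, A₁, ⟨st⟩⟩ := exists_stageData A
      obtain ⟨τ, ms, b, B, h1, h2⟩ := ih a (st.lt hA) A₁
      exact ⟨τ + 1, m₁ :: m₂ :: ms, b, B, .cons hA st h1, h2⟩

end Runs

/-! ### Normalizing the block form -/

section Ladder

variable {F : Type*} [DivisionRing F] [StarRing F] {ι κ μ β γ δ : Type*}
  [Fintype ι] [DecidableEq ι] [Fintype κ] [DecidableEq κ] [Fintype μ] [DecidableEq μ]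
  [Fintype β] [DecidableEq β] [Fintype γ] [DecidableEq γ] [Fintype δ] [DecidableEq δ]

/-- A stage form can be cleaned up by a block triangular transformation. -/
theorem stageForm_cong_of_eq {A : Matrix ι ι F} {B : Matrix ι κ F} {C : Matrix κ ι F}
    {D : Matrix κ κ F} {E : Matrix κ μ F} (hE : HasRightInv E) {Z : Matrix β ι F}
    {Z' : Matrix ι β F} (hZ : Z * Z' = 1) (hZ' : Z' * Z = 1) (G : Matrix κ ι F)
    {H : Matrix κ κ F} (hH : IsUnit H) {W : Matrix μ μ F} (hW : IsUnit W) :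
    Cong (stageForm A B C D E)
      (stageForm (Z * A * Zᴴ) (Z * A * Gᴴ + Z * B * Hᴴ) 0 0 (H * E * Wᴴ)) := by
  obtain ⟨H', hH'⟩ := hH.hasRightInv
  obtain ⟨W', hW'⟩ := hW.hasRightInv
  have hH'' := mul_eq_one_comm.1 hH'
  have hW'' := mul_eq_one_comm.1 hW'
  obtain ⟨E', hE'⟩ := hE
  let T : Matrix (β ⊕ κ) (ι ⊕ κ) F := fromBlocks Z 0 G H
  let T' : Matrix (ι ⊕ κ) (β ⊕ κ) F :=
    fromBlocks Z' 0 (-(H' * G * Z')) H'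
  have hT : T * T' = 1 := by
    simp only [T, T', fromBlocks_multiply, hZ, ← fromBlocks_one]
    simp [← Matrix.mul_assoc, hH']
  have hT' : T' * T = 1 := by
    simp only [T, T', fromBlocks_multiply, hZ', ← fromBlocks_one]
    simp [Matrix.mul_assoc, hZ', hH'']
  let Q := T * fromBlocks A B C D * Tᴴ
  -- The right inverse `E' * H'` of `H * E` is used to cancel the lower row of `Q`, which clears `C`
  -- and `D`. The matching row operation only adds zero rows.
  let X : Matrix (β ⊕ κ) μ F := (-(E' * H' * Q.toRows₂))ᴴ
  have h1 : T * fromRows (0 : Matrix ι μ F) E = fromRows (0 : Matrix β μ F) (H * E) := by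
    simp [T, fromBlocks_mul_fromRows]
  have h2 : H * E * Xᴴ = -Q.toRows₂ := by
    rw [conjTranspose_conjTranspose, Matrix.mul_neg, ← Matrix.mul_assoc, ← Matrix.mul_assoc,
      Matrix.mul_assoc _ E, hE', Matrix.mul_one, hH', Matrix.one_mul]
  refine ⟨fromBlocks T X 0 W,
    fromBlocks T' (-(T' * X * W')) 0 W', ?_, ?_, ?_⟩
  · rw [fromBlocks_multiply, ← fromBlocks_one]
    simp [hT, hW', ← Matrix.mul_assoc]
  · rw [fromBlocks_multiply, ← fromBlocks_one]
    simp [hT', hW'', Matrix.mul_assoc]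
  · rw [stageForm, stageForm, fromBlocks_conjTranspose, fromBlocks_multiply, fromBlocks_multiply]
    simp only [Matrix.mul_zero, Matrix.zero_mul, add_zero, conjTranspose_zero, h1, fromRows_mul,
      zero_add, h2]
    congr 1
    change Q + _ = _
    have h3 : Q.toRows₁ = fromCols (Z * A * Zᴴ) (Z * A * Gᴴ + Z * B * Hᴴ) := by
      simp only [Q, T, fromBlocks_conjTranspose, fromBlocks_multiply]
      ext i (j | j) <;> simp
    ext (i | i) j
    · have := congrFun (congrFun h3 i) j
      rw [toRows₁_apply] at this
      rw [Matrix.add_apply, this]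
      rcases j with j | j <;> simp
    · rcases j with j | j <;> simp

/-! ### Partial shifts on diagrams -/

/-- The matrix of a partial shift: the index at position `(l + 1, x)` is sent to the index at
position `(l, x)`, those at positions `(0, x)` to zero. -/
def ladder (F : Type*) [DivisionRing F] {γ : Type*} (p : γ → ℕ × ℕ) : Matrix γ γ F :=
  Matrix.of fun i j => if p i = ((p j).1 + 1, (p j).2) then 1 else 0

/-- `p` enumerates the positions `(l, x)` with `x < m_{l+1}`, where `ms = [m₁, m₂, …]`. -/
def IsDiagram {γ : Type*} (ms : List ℕ) (p : γ → ℕ × ℕ) : Prop :=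
  Function.Injective p ∧ ∀ l x, (∃ i, p i = (l, x)) ↔ x < ms.getD l 0

theorem getD_succ_le {ms : List ℕ} (h : ms.Pairwise (fun x y => x ≥ y)) (l : ℕ) :
    ms.getD (l + 1) 0 ≤ ms.getD l 0 := by
  by_cases hl : l + 1 < ms.length
  · rw [List.getD_eq_getElem _ _ hl, List.getD_eq_getElem _ _ (by omega)]
    exact List.pairwise_iff_getElem.1 h l (l + 1) (by omega) hl (by omega)
  · rw [List.getD_eq_default _ _ (by omega)]
    exact Nat.zero_le _

theorem getD_antitone {ms : List ℕ} (h : ms.Pairwise (fun x y => x ≥ y)) :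
    Antitone (fun l => ms.getD l 0) :=
  antitone_nat_of_succ_le (getD_succ_le h)

/-- The shift times its transpose is the projection that kills the positions `(0, x)`: since the
heights decrease, every `(l + 1, x)` has its target `(l, x)` in the diagram. So `(ladder F p)ᵀ * R`
solves a linear system with the shift as its matrix. -/
theorem ladder_mul_transpose_mul {ms : List ℕ} (hm : ms.Pairwise (fun x y => x ≥ y))
    {p : γ → ℕ × ℕ} (hp : IsDiagram ms p) {α : Type*} {R : Matrix γ α F}
    (hR : ∀ i, (p i).1 = 0 → R i = 0) : ladder F p * ((ladder F p)ᵀ * R) = R := by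
  ext i j
  rw [Matrix.mul_apply]
  obtain ⟨l, x, hl⟩ : ∃ l x, p i = (l, x) := ⟨_, _, rfl⟩
  rcases l with - | l
  · rw [hR i (by rw [hl]), Finset.sum_eq_zero]
    · rfl
    · intro k _
      simp [ladder, hl]
  · obtain ⟨k, hk⟩ := (hp.2 l x).2 (((hp.2 _ _).1 ⟨i, hl⟩).trans_le (getD_succ_le hm l))
    rw [Finset.sum_eq_single k]
    · rw [Matrix.mul_apply, Finset.sum_eq_single i]
      · simp [ladder, hl, hk]
      · intro i' _ hi'
        have : p i' ≠ (l + 1, x) := fun h => hi' (hp.1 (h.trans hl.symm))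
        simp [ladder, hk, this]
      · simp
    · intro k' _ hk'
      have : p i ≠ ((p k').1 + 1, (p k').2) := fun h => hk' (hp.1 (by
        rw [hl, Prod.mk.injEq] at h
        rw [hk]; ext <;> simp <;> omega))
      simp [ladder, this]
    · simp

/-- A stage form whose leading block is *congruent to `B₀ ⊕ ladder` has all its blocks in normal
form after a *congruence. -/
theorem stageForm_cong_ladder {m₁ m₂ : ℕ} {A : Matrix ι ι F} {B : Matrix ι (Fin m₂) F}
    {C : Matrix (Fin m₂) ι F} {D : Matrix (Fin m₂) (Fin m₂) F} {E : Matrix (Fin m₂) (Fin m₁) F}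
    (hE : HasRightInv E) (hAB : HasRightInv (fromCols A B)) {B₀ : Matrix β β F} (hB₀ : IsUnit B₀)
    {ms : List ℕ} (hm : ms.Pairwise (fun x y => x ≥ y)) {p : γ → ℕ × ℕ} (hp : IsDiagram ms p)
    (h : Cong A (directSum B₀ (ladder F p))) :
    ms.getD 0 0 ≤ m₂ ∧ ∃ h₁₂ : m₂ ≤ m₁, Cong (stageForm A B C D E)
      (stageForm (directSum B₀ (ladder F p))
        (fromRows 0 (Matrix.of fun i (x : Fin m₂) => if p i = (0, (x : ℕ)) then 1 else 0)) 0 0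
        (unitRows F (Fin.castLE h₁₂))) := by
  obtain ⟨Z, Z', hZ, hZ', hQ⟩ := h
  have h₁₂ : m₂ ≤ m₁ := by simpa using hE.card_le
  -- These are the rows of `Z * B` beside the zero rows of the shift. There `[A B]` has nothing else
  -- to make it independent, so `K` has independent rows.
  let K : Matrix {i : γ // (p i).1 = 0} (Fin m₂) F :=
    (Z * B).submatrix (fun i => Sum.inr i.1) id
  have hK : HasRightInv K := by
    have h1 : HasRightInv (fromCols (directSum B₀ (ladder F p)) (Z * B)) := by
      have h2 : fromCols (directSum B₀ (ladder F p)) (Z * B) =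
          Z * fromCols A B * fromBlocks Zᴴ 0 0 (1 : Matrix (Fin m₂) (Fin m₂) F) := by
        rw [mul_fromCols, fromCols_mul_fromBlocks, ← hQ]
        simp
      have h3 : HasRightInv Z := ⟨Z', hZ⟩
      have h4 : HasRightInv (fromBlocks Zᴴ 0 0 (1 : Matrix (Fin m₂) (Fin m₂) F)) := by
        refine ⟨fromBlocks Z'ᴴ 0 0 1, ?_⟩
        rw [fromBlocks_multiply, ← conjTranspose_mul, hZ']
        simp
      rw [h2]
      exact (h3.mul hAB).mul h4
    have h2 : HasRightInv (fromCols K (0 : Matrix _ (β ⊕ γ) F)) := by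
      convert h1.submatrix (f := fun i : {i : γ // (p i).1 = 0} => (Sum.inr i.1 : β ⊕ γ))
        (fun i j hij => Subtype.ext (Sum.inr_injective hij)) (Equiv.sumComm _ _) using 1
      ext i (j | j | j)
      · rfl
      · rfl
      · have : p i.1 ≠ ((p j).1 + 1, (p j).2) := fun h => by
          have := i.2
          rw [h] at this
          exact Nat.succ_ne_zero _ this
        simp [directSum, ladder, this]
    exact h2.of_fromCols_zero
  have hm₂ : ms.getD 0 0 ≤ m₂ := by
    have h1 : ∀ x : Fin (ms.getD 0 0), ∃ i, p i = (0, (x : ℕ)) := fun x => (hp.2 0 x).2 x.2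
    choose g hg using h1
    let g' : Fin (ms.getD 0 0) → {i : γ // (p i).1 = 0} := fun x => ⟨g x, by rw [hg]⟩
    have hg' : Function.Injective g' := fun x y hxy => by
      have h2 : g x = g y := congrArg Subtype.val hxy
      have h3 := hg x
      rw [h2, hg y, Prod.mk.injEq] at h3
      exact Fin.ext h3.2.symm
    have h2 := Fintype.card_le_of_injective g' hg'
    have h3 := hK.card_le
    rw [Fintype.card_fin] at h2 h3
    exact h2.trans h3
  let f : {i : γ // (p i).1 = 0} → Fin m₂ := fun i =>
    ⟨(p i.1).2, ((hp.2 0 _).1 ⟨i.1, Prod.ext i.2 rfl⟩).trans_le hm₂⟩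
  have hf : Function.Injective f := fun i j hij =>
    Subtype.ext (hp.1 (Prod.ext (i.2.trans j.2.symm) (congrArg Fin.val hij)))
  obtain ⟨Y, hY, hKY⟩ := hK.exists_mul_eq_unitRows hf
  obtain ⟨V, hV, hEV⟩ := ((isUnit_star.2 hY).hasRightInv.mul hE).exists_mul_eq_unitRows
    (Fin.castLE_injective h₁₂)
  obtain ⟨B₀', hB₀'⟩ := hB₀.hasRightInv
  set N : Matrix (β ⊕ γ) (Fin m₂) F :=
    fromRows 0 (Matrix.of fun i (x : Fin m₂) => if p i = (0, (x : ℕ)) then 1 else 0) with hN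
  -- `R` is the correction still needed once `Y` has normalized `K`. It vanishes beside the zero
  -- rows of the shift, so it is a combination `X` of the columns of the leading block.
  let R := N - Z * B * Y
  have hR : ∀ i, (p i).1 = 0 → R.toRows₂ i = 0 := fun i hi => by
    ext j
    have h1 := congrFun (congrFun hKY ⟨i, hi⟩) j
    have h2 : (K * Y) ⟨i, hi⟩ j = (Z * B * Y) (Sum.inr i) j := rfl
    have h3 : p i = (0, (j : ℕ)) ↔ f ⟨i, hi⟩ = j := by
      rw [Prod.ext_iff, Fin.ext_iff]
      simp [f, hi]
    rw [h2] at h1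
    change N (Sum.inr i) j - (Z * B * Y) (Sum.inr i) j = 0
    rw [h1]
    simp [hN, unitRows, h3]
  let X : Matrix (β ⊕ γ) (Fin m₂) F := fromRows (B₀' * R.toRows₁) ((ladder F p)ᵀ * R.toRows₂)
  have hX : directSum B₀ (ladder F p) * X = R := by
    rw [directSum, fromBlocks_mul_fromRows, ladder_mul_transpose_mul hm hp hR, ← Matrix.mul_assoc,
      hB₀']
    simp
  refine ⟨hm₂, h₁₂, ?_⟩
  -- With `G = Xᴴ * Z`, the term `Z * A * Gᴴ` equals `directSum B₀ (ladder F p) * X = R`, which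
  -- turns `Z * B * Y` into `N`.
  have key := stageForm_cong_of_eq (A := A) (B := B) (C := C) (D := D) hE hZ hZ' (Xᴴ * Z)
    (isUnit_star.2 hY) (isUnit_star.2 hV)
  simp only [star_eq_conjTranspose, conjTranspose_conjTranspose] at key hEV
  rw [hEV, conjTranspose_mul, conjTranspose_conjTranspose, ← Matrix.mul_assoc, hQ, hX,
    sub_add_cancel] at key
  exact key

/-- Add two columns to a diagram. -/
def extendDiagram (m₁ m₂ : ℕ) (p : γ → ℕ × ℕ) : (γ ⊕ Fin m₂) ⊕ Fin m₁ → ℕ × ℕ :=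
  Sum.elim (Sum.elim (fun i => ((p i).1 + 2, (p i).2)) fun x => (1, (x : ℕ))) fun x => (0, (x : ℕ))

theorem IsDiagram.extend {ms : List ℕ} {p : γ → ℕ × ℕ} (hp : IsDiagram ms p) (m₁ m₂ : ℕ) :
    IsDiagram (m₁ :: m₂ :: ms) (extendDiagram m₁ m₂ p) := by
  constructor
  · rintro ((i | i) | i) ((j | j) | j) h <;>
      simp [extendDiagram, Prod.ext_iff, Fin.ext_iff] at h ⊢ <;> try omega
    exact hp.1 (Prod.ext h.1 h.2)
  · rintro (- | - | l) x
    · simp only [extendDiagram, Sum.exists, Sum.elim_inl, Sum.elim_inr, Prod.mk.injEq]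
      simp [Fin.exists_iff]
    · simp only [extendDiagram, Sum.exists, Sum.elim_inl, Sum.elim_inr, Prod.mk.injEq]
      simp [Fin.exists_iff]
    · have := hp.2 l x
      simp only [Prod.ext_iff] at this
      rw [List.getD_cons_succ, List.getD_cons_succ, ← this]
      simp [extendDiagram, Prod.ext_iff]

/-- The remains of `B` are the steps from column 2 to column 1 of the new diagram, and those of `E`
the steps from column 1 to column 0. -/
theorem directSum_ladder_extendDiagram {m₁ m₂ : ℕ} (h₁₂ : m₂ ≤ m₁) (B₀ : Matrix β β F)
    (p : γ → ℕ × ℕ) :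
    (directSum B₀ (ladder F (extendDiagram m₁ m₂ p))).submatrix
      ((Equiv.sumCongr (Equiv.sumAssoc β γ (Fin m₂)) (Equiv.refl (Fin m₁))).trans
        (Equiv.sumAssoc _ _ _))
      ((Equiv.sumCongr (Equiv.sumAssoc β γ (Fin m₂)) (Equiv.refl (Fin m₁))).trans
        (Equiv.sumAssoc _ _ _)) =
    stageForm (directSum B₀ (ladder F p))
      (fromRows 0 (Matrix.of fun i (x : Fin m₂) => if p i = (0, (x : ℕ)) then 1 else 0)) 0 0
      (unitRows F (Fin.castLE h₁₂)) := by
  ext (((i | i) | i) | i) (((j | j) | j) | j) <;>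
    simp [directSum, ladder, extendDiagram, unitRows, Prod.ext_iff, Fin.ext_iff]

theorem IsDiagram.cong {ms : List ℕ} {p : γ → ℕ × ℕ} {q : δ → ℕ × ℕ} (hp : IsDiagram ms p)
    (hq : IsDiagram ms q) (B₀ : Matrix β β F) :
    Cong (directSum B₀ (ladder F p)) (directSum B₀ (ladder F q)) := by
  have h1 : ∀ i : γ, ∃ j : δ, q j = p i := fun i =>
    (hq.2 (p i).1 (p i).2).2 ((hp.2 _ _).1 ⟨i, rfl⟩)
  choose e he using h1
  have hb : Function.Bijective e := by
    refine ⟨fun i j hij => hp.1 (by rw [← he, hij, he]), fun j => ?_⟩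
    obtain ⟨i, hi⟩ := (hp.2 (q j).1 (q j).2).2 ((hq.2 _ _).1 ⟨j, rfl⟩)
    exact ⟨i, hq.1 (by rw [he, hi])⟩
  have h2 := Cong.submatrix (directSum B₀ (ladder F q))
    (Equiv.sumCongr (Equiv.refl β) (Equiv.ofBijective e hb))
  refine Cong.symm ?_
  convert h2 using 1
  ext (i | i) (j | j) <;> simp [directSum, ladder, he]

/-- Induction from the nonsingular end, where the diagram is empty; each stage undone prepends two
columns, together with the inequalities that keep the heights decreasing. -/
theorem Stages.exists_ladder {n a k : ℕ} {A : Matrix (Fin n) (Fin n) F} {ms : List ℕ}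
    {B : Matrix (Fin a) (Fin a) F} (s : Stages A k ms B) (hB : IsUnit B) :
    ms.length = 2 * k ∧ ms.Pairwise (fun x y => x ≥ y) ∧
      ∃ (γ : Type) (_ : Fintype γ) (_ : DecidableEq γ) (p : γ → ℕ × ℕ), IsDiagram ms p ∧
        Cong A (directSum B (ladder F p)) := by
  induction s with
  | nil A =>
    refine ⟨rfl, List.Pairwise.nil, Empty, inferInstance, inferInstance, Empty.elim,
      ⟨fun i => i.elim, fun l x => by simp⟩, ?_⟩
    convert Cong.submatrix A (Equiv.sumEmpty _ Empty) using 1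
    ext (i | i) (j | j)
    · rfl
    · exact j.elim
    · exact i.elim
    · exact i.elim
  | @cons n a b A A₁ B m₁ m₂ k ms hs st _ ih =>
    obtain ⟨hl, hm, γ, _, _, p, hp, hA⟩ := ih hB
    obtain ⟨h₂₃, h₁₂, h⟩ := stageForm_cong_ladder (C := st.C) (D := st.D) st.hasRightInv_E
      st.hasRightInv_top.of_top hB hm hp hA
    refine ⟨by simp [hl]; ring, ?_, (γ ⊕ Fin m₂) ⊕ Fin m₁, inferInstance, inferInstance, _,
      hp.extend m₁ m₂, ?_⟩
    · have h2 : ∀ x ∈ ms, m₂ ≥ x := by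
        intro x hx
        obtain ⟨i, hi, rfl⟩ := List.getElem_of_mem hx
        have := getD_antitone hm (Nat.zero_le i)
        simp only [List.getD_eq_getElem _ _ hi] at this
        exact this.trans h₂₃
      refine List.pairwise_cons.2 ⟨?_, List.pairwise_cons.2 ⟨h2, hm⟩⟩
      intro x hx
      rcases List.mem_cons.1 hx with rfl | hx
      · exact h₁₂
      · exact (h2 x hx).trans h₁₂
    · rw [← directSum_ladder_extendDiagram] at h
      exact (st.cong_stageForm.trans h).trans (Cong.submatrix _ _).symm

/-! ### Lines of the diagram as Jordan blocks -/

/-- The position of an index of the singular part: the `j`-th index of a Jordan block `J_{i+1}` is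
`i - j` steps away from the end of its chain. -/
def singularPartPosition (ms : List ℕ) :
    (Σ i : Fin ms.length, Fin ((i : ℕ) + 1) × Fin (ms.getD i 0 - ms.getD (i + 1) 0)) → ℕ × ℕ :=
  fun z => ((z.1 : ℕ) - (z.2.1 : ℕ), ms.getD (z.1 + 1) 0 + (z.2.2 : ℕ))

/-- For decreasing heights the intervals `[m_{i+2}, m_{i+1})` are disjoint, so the line `x`
determines the size `i + 1` of its Jordan block. -/
theorem eq_of_getD_le_of_lt {ms : List ℕ} (hm : ms.Pairwise (fun x y => x ≥ y)) {i j x : ℕ}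
    (hi : ms.getD (i + 1) 0 ≤ x) (hi' : x < ms.getD i 0) (hj : ms.getD (j + 1) 0 ≤ x)
    (hj' : x < ms.getD j 0) : i = j := by
  by_contra hne
  rcases Nat.lt_or_gt_of_ne hne with h | h
  · have := getD_antitone hm (show i + 1 ≤ j from h)
    exact absurd (hj'.trans_le (this.trans hi)) (lt_irrefl _)
  · have := getD_antitone hm (show j + 1 ≤ i from h)
    exact absurd (hi'.trans_le (this.trans hj)) (lt_irrefl _)

theorem singularPartPosition_fst_eq {ms : List ℕ} (hm : ms.Pairwise (fun x y => x ≥ y))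
    {z w : Σ i : Fin ms.length, Fin ((i : ℕ) + 1) × Fin (ms.getD i 0 - ms.getD (i + 1) 0)}
    (h : (singularPartPosition ms z).2 = (singularPartPosition ms w).2) : z.1 = w.1 := by
  have h1 := z.2.2.2
  have h2 := w.2.2.2
  simp only [singularPartPosition] at h
  exact Fin.ext (eq_of_getD_le_of_lt hm (x := ms.getD (z.1 + 1) 0 + (z.2.2 : ℕ)) (by omega)
    (by omega) (by omega) (by omega))

theorem isDiagram_singularPartPosition {ms : List ℕ} (hm : ms.Pairwise (fun x y => x ≥ y)) :
    IsDiagram ms (singularPartPosition ms) := by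
  constructor
  · intro z w h
    have h1 := singularPartPosition_fst_eq hm (congrArg Prod.snd h)
    obtain ⟨i, j, y⟩ := z
    obtain ⟨i', j', y'⟩ := w
    obtain rfl : i = i' := h1
    simp only [singularPartPosition, Prod.mk.injEq] at h
    have hj : j = j' := Fin.ext (by omega)
    have hy : y = y' := Fin.ext (by omega)
    rw [hj, hy]
  · intro l x
    constructor
    · rintro ⟨⟨i, j, y⟩, h⟩
      simp only [singularPartPosition, Prod.mk.injEq] at h
      obtain ⟨rfl, rfl⟩ := h
      have h1 := y.2
      have h2 := getD_antitone hm (Nat.sub_le (i : ℕ) (j : ℕ))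
      simp only at h2
      omega
    · intro h
      -- The first column not reaching line `x` gives the length of that line; it exists because
      -- heights past the end of the list read as `0`.
      have hex : ∃ i, ms.getD i 0 ≤ x :=
        ⟨ms.length, by rw [List.getD_eq_default _ _ le_rfl]; exact Nat.zero_le _⟩
      have h1 := Nat.find_spec hex
      have h2 : ∀ i < Nat.find hex, x < ms.getD i 0 := fun i hi =>
        not_le.1 (Nat.find_min hex hi)
      have h3 : l < Nat.find hex := by
        by_contra hl
        have := getD_antitone hm (not_lt.1 hl)
        simp only at this
        omega
      obtain ⟨i, hi⟩ : ∃ i, Nat.find hex = i + 1 := ⟨Nat.find hex - 1, by omega⟩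
      rw [hi] at h1 h2 h3
      have h4 := h2 i (by omega)
      have h5 : i < ms.length := by
        by_contra hl
        rw [List.getD_eq_default _ _ (not_lt.1 hl)] at h4
        omega
      refine ⟨⟨⟨i, h5⟩, ⟨i - l, by simp only; omega⟩, ⟨x - ms.getD (i + 1) 0,
        by simp only; omega⟩⟩, ?_⟩
      simp only [singularPartPosition, Prod.mk.injEq]
      omega

theorem singularPart_eq_ladder {ms : List ℕ} (hm : ms.Pairwise (fun x y => x ≥ y)) :
    singularPart F ms = ladder F (singularPartPosition ms) := by
  ext z w
  by_cases h : z.1 = w.1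
  · obtain ⟨i, j, y⟩ := z
    obtain ⟨i', j', y'⟩ := w
    obtain rfl : i = i' := h
    have hj' := j'.2
    have hj := j.2
    rw [singularPart, blockDiagonal'_apply_eq, blockDiagonal_apply, ladder, Matrix.of_apply]
    simp only [jordan, Matrix.of_apply, singularPartPosition, Prod.mk.injEq, ← ite_and,
      Fin.ext_iff]
    congr 1
    apply propext
    constructor <;> intro h <;> omega
  · rw [singularPart, blockDiagonal'_apply_ne _ _ _ h, ladder, Matrix.of_apply, if_neg]
    intro h'
    have h2 := congrArg Prod.snd h'
    exact h (singularPartPosition_fst_eq hm h2)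

end Ladder

end StarReg

/-! ### The theorem -/

theorem mainTheorem2 {F : Type*} [DivisionRing F] [StarRing F] {n : ℕ}
    (A : Matrix (Fin n) (Fin n) F) (hA : ¬ IsUnit A) :
    -- the algorithm can be carried out, never gets stuck, and stops after at most `n` stages
    (∃ (τ : ℕ) (ms : List ℕ) (a : ℕ) (B : Matrix (Fin a) (Fin a) F), StarReg.Run A τ ms B) ∧
    (∀ (k : ℕ) (ms : List ℕ) (a : ℕ) (B : Matrix (Fin a) (Fin a) F), StarReg.Stages A k ms B →
      k ≤ n ∧ (¬ IsUnit B →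
        (∃ (m₁ m₂ b : ℕ) (B₁ : Matrix (Fin b) (Fin b) F),
          Nonempty (StarReg.StageData B m₁ m₂ B₁)) ∧
        (∀ (m₁ m₂ b : ℕ) (B₁ : Matrix (Fin b) (Fin b) F),
          Nonempty (StarReg.StageData B m₁ m₂ B₁) → b < a))) ∧
    -- every run yields a regularizing decomposition
    (∀ (τ : ℕ) (ms : List ℕ) (a : ℕ) (B : Matrix (Fin a) (Fin a) F), StarReg.Run A τ ms B →
      ms.length = 2 * τ ∧ ms.Pairwise (fun x y => x ≥ y) ∧ IsUnit B ∧
        StarReg.StarCongruent A (StarReg.directSum B (StarReg.singularPart F ms))) ∧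
    -- the result of a run depends only on the *congruence class
    (∀ A' : Matrix (Fin n) (Fin n) F, StarReg.StarCongruent A A' →
      ∀ (τ τ' : ℕ) (ms ms' : List ℕ) (a a' : ℕ)
        (B : Matrix (Fin a) (Fin a) F) (B' : Matrix (Fin a') (Fin a') F),
        StarReg.Run A τ ms B → StarReg.Run A' τ' ms' B' →
          τ = τ' ∧ ms = ms' ∧ StarReg.StarCongruent B B') := by
  refine ⟨StarReg.exists_run A, ?_, ?_, ?_⟩
  · intro k ms a B s
    have := s.add_le
    exact ⟨by omega, fun hB => ⟨StarReg.exists_stageData B, fun _ _ _ _ ⟨st⟩ => st.lt hB⟩⟩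
  · rintro τ ms a B ⟨s, hB⟩
    obtain ⟨hl, hm, γ, _, _, p, hp, h⟩ := s.exists_ladder hB
    refine ⟨hl, hm, hB, ?_⟩
    rw [← StarReg.cong_iff_starCongruent, StarReg.singularPart_eq_ladder hm]
    exact h.trans (hp.cong (StarReg.isDiagram_singularPartPosition hm) B)
  · rintro A' hAA' τ τ' ms ms' a a' B B' ⟨s, hB⟩ ⟨s', hB'⟩
    rw [← StarReg.cong_iff_starCongruent] at hAA' ⊢
    exact s.unique s' hB hB' hAA'
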